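/- Fix an infinite set $F$ of node features. A graph $G=(V,E,X)$ is a finite simple undirected graph $(V,E)$ with a feature map $X:V\to F$. For a graph $G$ (with features in an arbitrary set), $k\ge 2$ and $\mathbf u\in V^k$, the color $c_k^0(\mathbf u,G)$ is the isomorphism type of $\mathbf u$: tuples $\mathbf u$ of $G$ and $\mathbf u'$ of $G'=(V',E',X')$ have the same isomorphism type iff for all $i,j\in[k]$: $\mathbf u_i=\mathbf u_j\Leftrightarrow \mathbf u'_i=\mathbf u'_j$; $X_{\mathbf u_i}=X'_{\mathbf u'_i}$; and $\{\mathbf u_i,\mathbf u_j\}\in E\Leftrightarrow\{\mathbf u'_i,\mathbf u'_j\}\in E'$. For $t\ge 0$ put $$c_k^{t+1}(\mathbf u,G)=\Bigl(c_k^{t}(\mathbf u,G),\bigl(\{\!\{c_k^{t}(\psi_i(\mathbf u,w),G): w\in V\}\!\}\bigr)_{i\in[k]}\Bigr),\qquad c_k^t(G)=\{\!\{c_k^t(\mathbf u,G):\mathbf u\in V^k\}\!\},$$ where $\psi_i(\mathbf u,w)$ is $\mathbf u$ with its $i$-th entry replaced by $w$. For $l\ge 0$ and $\mathbf v\in V^l$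 let $G^{\mathbf v}=(V,E,X^{\mathbf v})$ be the labeled graph with $X^{\mathbf v}_w=(X_w,\{i\in[l]:\mathbf v_i=w\})$. The color of $G$ under $k,l$-WL in round $t$ is $c^t_{k,l}(G)=\{\!\{c_k^t(G^{\mathbf v}):\mathbf v\in V^l\}\!\}$. Two graphs $G,H$ have the same final color under $k,l$-WL if $c^t_{k,l}(G)=c^t_{k,l}(H)$ for a round $t$ that is stable for $G,H$, i.e. such that any two $k$-tuples of labeled graphs $G^{\mathbf v},H^{\mathbf v'}$ ($\mathbf v\in V(G)^l$, $\mathbf v'\in V(H)^l$), from the same or from different labeled graphs, that have the same color in round $t$ also have the same color in round $t+1$. (A stable round always exists, and the choice of the stable round does not matter.) For algorithms $A,B$ write $B\preceq A$ if any two graphs with the same final color under $A$ have the same final color under $B$, and $B\prec A$ ($A$ is strictly more powerful than $B$) if $B\preceq A$ and not $A\preceq B$. **Theorem.** For all $k\ge 2$ and $l\ge 0$, $k,l$-WL $\prec$ $k+1,l$-WL. That is, any two graphs with the same final color under $k+1,l$-WL have the same final color under $k,l$-WL, and there are two graphs with the same final color under $k,l$-WL but different final colors under $k+1,l$-WL.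 -/

import Mathlib

namespace KLWL

universe u

/-- A finite undirected graph `G = (V, E, X)` whose nodes carry features in `F`. -/
structure FeaturedGraph (F : Type u) where
  V : Type
  [fintypeV : Fintype V]
  graph : SimpleGraph V
  feature : V → F

attribute [instance] FeaturedGraph.fintypeV

/-- The labeled graph `G^v` of an `l`-tuple `v` of nodes: the feature of the node `w` is extended by
the collection of all indices `i` with `v i = w`. -/
def FeaturedGraph.label {F : Type u} (G : FeaturedGraph F) {l : ℕ} (v : Fin l → G.V) :
    FeaturedGraph (F × Set (Fin l)) where
  V := G.V
  graph := G.graph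
  feature := fun w => (G.feature w, {i | v i = w})

/-- Isomorphism types of `k`-tuples: the equality pattern, the features and the adjacency pattern.
Two such records are equal iff the patterns are equivalent entry by entry and the features agree. -/
@[ext]
structure IsoType (F : Type u) (k : ℕ) where
  eqPattern : Fin k → Fin k → Prop
  features : Fin k → F
  adjPattern : Fin k → Fin k → Prop

/-- The isomorphism type of a `k`-tuple of nodes. -/
def isoType {F : Type u} (G : FeaturedGraph F) {k : ℕ} (x : Fin k → G.V) : IsoType F k where
  eqPattern := fun i j => x i = x j
  features := fun i => G.feature (x i)
  adjPattern := fun i j => G.graph.Adj (x i) (x j)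

/-- The colors of `k`-tuples after `t` rounds. The injective function `Hash` is the identity, so a
color of round `t + 1` is the pair of the old color and the `k`-tuple of multisets of old colors. -/
def TupleColor (F : Type u) (k : ℕ) : ℕ → Type u
  | 0 => IsoType F k
  | t + 1 => TupleColor F k t × (Fin k → Multiset (TupleColor F k t))

/-- The color `c_k^t(x, G)` that `k`-WL (for `k ≥ 2`) gives to the `k`-tuple `x` in round `t`. -/
def tupleColor {F : Type u} (G : FeaturedGraph F) {k : ℕ} :
    (t : ℕ) → (Fin k → G.V) → TupleColor F k t
  | 0, x => isoType G x
  | t + 1, x =>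
      (tupleColor G t x,
        fun i => (Finset.univ : Finset G.V).val.map fun w => tupleColor G t (Function.update x i w))

/-- The color `c_k^t(G)`: the multiset of the colors of all `k`-tuples. -/
def wlColor {F : Type u} (k t : ℕ) (G : FeaturedGraph F) : Multiset (TupleColor F k t) :=
  (Finset.univ : Finset (Fin k → G.V)).val.map fun x => tupleColor G t x

/-- The color `c_{k,l}^t(G)` of `k,l`-WL: the multiset of the `k`-WL colors of all labeled graphs. -/
def klColor {F : Type u} (k l t : ℕ) (G : FeaturedGraph F) :
    Multiset (Multiset (TupleColor (F × Set (Fin l)) k t)) :=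
  (Finset.univ : Finset (Fin l → G.V)).val.map fun v => wlColor k t (G.label v)

/-- The round-`t` colors of all tuples (in all labeled graphs) of two graphs, taken together. -/
def pairTupleColor {F : Type u} (k l : ℕ) (G H : FeaturedGraph F) (t : ℕ) :
    ((Fin l → G.V) × (Fin k → G.V)) ⊕ ((Fin l → H.V) × (Fin k → H.V)) →
      TupleColor (F × Set (Fin l)) k t
  | Sum.inl p => tupleColor (G.label p.1) t p.2
  | Sum.inr p => tupleColor (H.label p.1) t p.2

/-- On the pair `G, H` the coloring of `k,l`-WL is stable in round `t`: the next round does not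
separate any two tuples that have the same color. -/
def StableAt {F : Type u} (k l : ℕ) (G H : FeaturedGraph F) (t : ℕ) : Prop :=
  ∀ a b, pairTupleColor k l G H t a = pairTupleColor k l G H t b ↔
    pairTupleColor k l G H (t + 1) a = pairTupleColor k l G H (t + 1) b

/-- A coloring algorithm for graphs, given by the relation "`G` and `H` get the same final color". -/
abbrev Algorithm (F : Type u) := FeaturedGraph F → FeaturedGraph F → Prop

/-- `k,l`-WL (for `k ≥ 2`): two graphs get the same final color iff their colors agree in a round in
which the coloring is stable. Such a round exists, and all such rounds give the same answer: see
`exists_stableAt` and `klWL_iff_of_stableAt`. -/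
def klWL {F : Type u} (k l : ℕ) : Algorithm F := fun G H =>
  ∃ t, StableAt k l G H t ∧ klColor k l t G = klColor k l t H

/-- `B ≼ A`: the algorithm `A` is more powerful than `B`. -/
def Preceq {F : Type u} (B A : Algorithm F) : Prop :=
  ∀ G H : FeaturedGraph F, A G H → B G H

/-- `A ≅ B`: the algorithms are equally powerful. -/
def Equipowerful {F : Type u} (A B : Algorithm F) : Prop :=
  Preceq B A ∧ Preceq A B

/-- `B ≺ A`: the algorithm `A` is strictly more powerful than `B`. -/
def Prec {F : Type u} (B A : Algorithm F) : Prop :=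
  Preceq B A ∧ ¬ Equipowerful A B

theorem pairTupleColor_of_succ {F : Type u} {k l : ℕ} {G H : FeaturedGraph F} {t : ℕ} {a b}
    (h : pairTupleColor k l G H (t + 1) a = pairTupleColor k l G H (t + 1) b) :
    pairTupleColor k l G H t a = pairTupleColor k l G H t b := by
  have := congrArg Prod.fst h
  rcases a with a | a <;> rcases b with b | b <;> exact this

theorem exists_stableAt {F : Type u} (k l : ℕ) (G H : FeaturedGraph F) :
    ∃ t, StableAt k l G H t := by
  classical
  by_contra hcon
  push Not at hcon
  let S : ℕ → Finset ((((Fin l → G.V) × (Fin k → G.V)) ⊕ ((Fin l → H.V) × (Fin k → H.V))) ×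
      (((Fin l → G.V) × (Fin k → G.V)) ⊕ ((Fin l → H.V) × (Fin k → H.V)))) := fun t =>
    Finset.univ.filter fun p => pairTupleColor k l G H t p.1 = pairTupleColor k l G H t p.2
  have hS : StrictAnti fun t => (S t).card := by
    refine strictAnti_nat_of_succ_lt fun t => Finset.card_lt_card ?_
    have hsub : S (t + 1) ⊆ S t := fun p hp => by
      simp only [S, Finset.mem_filter, Finset.mem_univ, true_and] at hp ⊢
      exact pairTupleColor_of_succ hp
    refine hsub.ssubset_of_ne fun heq => hcon t fun a b => ⟨fun h => ?_, pairTupleColor_of_succ⟩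
    have : (a, b) ∈ S (t + 1) := by rw [heq]; simpa [S] using h
    simpa [S] using this
  have hle : ∀ t, (S t).card + t ≤ (S 0).card := fun t => by
    induction t with
    | zero => simp
    | succ t ih =>
      have := hS (Nat.lt_succ_self t)
      simp only [Nat.succ_eq_add_one] at this
      omega
  have := hle ((S 0).card + 1)
  omega

theorem klColor_of_succ {F : Type u} {k l t : ℕ} {G H : FeaturedGraph F}
    (h : klColor k l (t + 1) G = klColor k l (t + 1) H) :
    klColor k l t G = klColor k l t H := by
  have key : ∀ K : FeaturedGraph F, klColor k l t K =
      (klColor k l (t + 1) K).map (fun m => m.map (fun c => (Prod.fst c : TupleColor _ k t))) := by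
    intro K
    simp only [klColor, wlColor, Multiset.map_map]
    refine Multiset.map_congr rfl fun v _ => ?_
    exact (Multiset.map_map (fun c => (Prod.fst c : TupleColor _ k t))
      (fun x => tupleColor (K.label v) (t + 1) x) Finset.univ.val).symm
  rw [key, key, h]

/-- In a stable round the next colors are a function of the present ones. -/
theorem StableAt.exists_map {F : Type u} {k l t : ℕ} {G H : FeaturedGraph F}
    (hs : StableAt k l G H t)
    (a₀ : ((Fin l → G.V) × (Fin k → G.V)) ⊕ ((Fin l → H.V) × (Fin k → H.V))) :
    ∃ φ : TupleColor (F × Set (Fin l)) k t → TupleColor (F × Set (Fin l)) k (t + 1),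
      ∀ a, pairTupleColor k l G H (t + 1) a = φ (pairTupleColor k l G H t a) := by
  classical
  refine ⟨fun c => if h : ∃ a, pairTupleColor k l G H t a = c then
    pairTupleColor k l G H (t + 1) h.choose else pairTupleColor k l G H (t + 1) a₀, fun a => ?_⟩
  have h : ∃ b, pairTupleColor k l G H t b = pairTupleColor k l G H t a := ⟨a, rfl⟩
  simp only [dif_pos h]
  exact (hs _ _).1 h.choose_spec.symm

theorem StableAt.succ {F : Type u} {k l t : ℕ} {G H : FeaturedGraph F}
    (hs : StableAt k l G H t) : StableAt k l G H (t + 1) := by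
  intro a b
  refine ⟨fun h => ?_, pairTupleColor_of_succ⟩
  obtain ⟨φ, hφ⟩ := hs.exists_map a
  have hl : ∀ v x, tupleColor (G.label v) (t + 1) x = φ (tupleColor (G.label v) t x) :=
    fun v x => hφ (Sum.inl (v, x))
  have hr : ∀ v x, tupleColor (H.label v) (t + 1) x = φ (tupleColor (H.label v) t x) :=
    fun v x => hφ (Sum.inr (v, x))
  have key : ∀ c i, Prod.snd (pairTupleColor k l G H (t + 1 + 1) c) i =
      (Prod.snd (pairTupleColor k l G H (t + 1) c) i).map φ := by
    rintro (⟨v, x⟩ | ⟨v, x⟩) i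
    · exact (Multiset.map_congr rfl fun w _ => hl v (Function.update x i w)).trans
        (Multiset.map_map φ (fun w => tupleColor (G.label v) t (Function.update x i w))
          Finset.univ.val).symm
    · exact (Multiset.map_congr rfl fun w _ => hr v (Function.update x i w)).trans
        (Multiset.map_map φ (fun w => tupleColor (H.label v) t (Function.update x i w))
          Finset.univ.val).symm
  refine Prod.ext ?_ ?_
  · rcases a with a | a <;> rcases b with b | b <;> exact h
  · funext i
    rw [key, key, h]

theorem StableAt.klColor_succ {F : Type u} {k l t : ℕ} {G H : FeaturedGraph F}
    (hs : StableAt k l G H t) (h : klColor k l t G = klColor k l t H) :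
    klColor k l (t + 1) G = klColor k l (t + 1) H := by
  by_cases hne : Nonempty
    (((Fin l → G.V) × (Fin k → G.V)) ⊕ ((Fin l → H.V) × (Fin k → H.V)))
  · obtain ⟨a₀⟩ := hne
    obtain ⟨φ, hφ⟩ := hs.exists_map a₀
    have hl : ∀ v x, tupleColor (G.label v) (t + 1) x = φ (tupleColor (G.label v) t x) :=
      fun v x => hφ (Sum.inl (v, x))
    have hr : ∀ v x, tupleColor (H.label v) (t + 1) x = φ (tupleColor (H.label v) t x) :=
      fun v x => hφ (Sum.inr (v, x))
    have h3 := congrArg (Multiset.map (Multiset.map φ)) h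
    simp only [klColor, wlColor, Multiset.map_map, Function.comp_def] at h3
    simp only [klColor, wlColor, hl, hr]
    exact h3
  · have hG : ∀ v : Fin l → G.V, IsEmpty (Fin k → G.V) := fun v =>
      ⟨fun x => hne ⟨Sum.inl (v, x)⟩⟩
    have hH : ∀ v : Fin l → H.V, IsEmpty (Fin k → H.V) := fun v =>
      ⟨fun x => hne ⟨Sum.inr (v, x)⟩⟩
    have eG : ∀ s, klColor k l s G = Multiset.replicate (Fintype.card (Fin l → G.V)) 0 := by
      intro s
      refine Multiset.eq_replicate.2 ⟨by simp [klColor], fun m hm => ?_⟩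
      obtain ⟨v, -, rfl⟩ := Multiset.mem_map.1 hm
      have := hG v
      exact Multiset.eq_zero_of_forall_notMem fun c hc => by
        obtain ⟨x, -, -⟩ := Multiset.mem_map.1 hc
        exact this.elim x
    have eH : ∀ s, klColor k l s H = Multiset.replicate (Fintype.card (Fin l → H.V)) 0 := by
      intro s
      refine Multiset.eq_replicate.2 ⟨by simp [klColor], fun m hm => ?_⟩
      obtain ⟨v, -, rfl⟩ := Multiset.mem_map.1 hm
      have := hH v
      exact Multiset.eq_zero_of_forall_notMem fun c hc => by
        obtain ⟨x, -, -⟩ := Multiset.mem_map.1 hc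
        exact this.elim x
    have hc := congrArg Multiset.card h
    simp only [eG, eH, Multiset.card_replicate] at hc
    rw [eG, eH, hc]

theorem klColor_of_le {F : Type u} {k l s t : ℕ} {G H : FeaturedGraph F} (hst : s ≤ t)
    (h : klColor k l t G = klColor k l t H) : klColor k l s G = klColor k l s H := by
  induction hst with
  | refl => exact h
  | step _ ih => exact ih (klColor_of_succ h)

/-- Two graphs get the same final color iff their colors agree in every round. -/
theorem klWL_iff_forall {F : Type u} {k l : ℕ} {G H : FeaturedGraph F} :
    klWL k l G H ↔ ∀ t, klColor k l t G = klColor k l t H := by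
  constructor
  · rintro ⟨t, hs, h⟩ s
    have key : ∀ n, StableAt k l G H (t + n) ∧ klColor k l (t + n) G = klColor k l (t + n) H := by
      intro n
      induction n with
      | zero => exact ⟨hs, h⟩
      | succ n ih => exact ⟨ih.1.succ, ih.1.klColor_succ ih.2⟩
    exact klColor_of_le (Nat.le_add_left s t) (key s).2
  · intro h
    obtain ⟨t, ht⟩ := exists_stableAt k l G H
    exact ⟨t, ht, h t⟩

/-- Every stable round decides whether two graphs get the same final color. -/
theorem klWL_iff_of_stableAt {F : Type u} {k l t : ℕ} {G H : FeaturedGraph F}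
    (hs : StableAt k l G H t) : klWL k l G H ↔ klColor k l t G = klColor k l t H :=
  ⟨fun h => klWL_iff_forall.1 h t, fun h => ⟨t, hs, h⟩⟩

end KLWL

/-! A `k`-tuple can be coded as the `(k + 1)`-tuple whose last entry repeats the first, and the
color of the longer tuple determines that of the shorter one. Hence `(k + 1)`-WL colors determine
`k`-WL colors, for each labeled graph separately (`preceq_klWL_succ`).

Strictness uses two Cai–Fürer–Immerman graphs over `base k l`, which differ by a twist at the
center. The `l` labels miss one of the `l + 1` cliques. The twist is moved along the edge from the
center into that clique; since the clique has more than `k` nodes, the twist can always be kept away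
from the `k` entries of a tuple, so `k,l`-WL sees no difference (`klColor_cfi_base`). With `k + 1`
entries one can start at the center, find an edge to a clique whose bit is wrong, and then occupy
that whole clique. The parities inside it force the bit on that edge to be zero, a contradiction
(`klColor_succ_cfi_base_ne`). -/

namespace KLWL

/-! ### Colors of `k`-tuples from colors of `(k + 1)`-tuples -/

section Monotonicity

variable {F : Type*} {k : ℕ}

/-- The color of the first `k` entries of a `(k + 1)`-tuple, computed from the color of the tuple. -/
def restrictColor : (t : ℕ) → TupleColor F (k + 1) t → TupleColor F k t
  | 0, c => IsoType.mk (fun i j => IsoType.eqPattern c i.castSucc j.castSucc)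
      (fun i => IsoType.features c i.castSucc)
      (fun i j => IsoType.adjPattern c i.castSucc j.castSucc)
  | t + 1, c => (restrictColor t (Prod.fst c),
      fun i => (Prod.snd c i.castSucc).map (restrictColor t))

/-- Replacing one of the first `k` entries commutes with dropping the last entry; the multiset
belonging to the last position is discarded. -/
theorem restrictColor_tupleColor (G : FeaturedGraph F) (t : ℕ) (x : Fin (k + 1) → G.V) :
    restrictColor t (tupleColor G t x) = tupleColor G t fun i => x i.castSucc := by
  induction t generalizing x with
  | zero => rfl
  | succ t ih =>
    refine Prod.ext (ih x) (funext fun i => ?_)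
    refine (Multiset.map_map _ _ _).trans (Multiset.map_congr rfl fun w _ => ?_)
    refine (ih _).trans (congrArg _ ?_)
    exact Function.update_comp_eq_of_injective x (Fin.castSucc_injective k) i w

/-- The isomorphism type recorded in a color. -/
def initialColor : (t : ℕ) → TupleColor F k t → IsoType F k
  | 0, c => c
  | t + 1, c => initialColor t (Prod.fst c)

theorem initialColor_tupleColor (G : FeaturedGraph F) (t : ℕ) (x : Fin k → G.V) :
    initialColor t (tupleColor G t x) = isoType G x := by
  induction t with
  | zero => rfl
  | succ t ih => exact ih

open Classical in
/-- The `k`-WL color of a graph is determined by its `(k + 1)`-WL color: every `k`-tuple extends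
uniquely to a `(k + 1)`-tuple whose last entry repeats the first one. -/
theorem wlColor_eq_map_restrictColor (hk : 0 < k) (t : ℕ) (G : FeaturedGraph F) :
    wlColor k t G = ((wlColor (k + 1) t G).filter fun c =>
      (initialColor t c).eqPattern (Fin.last k) 0).map (restrictColor t) := by
  obtain ⟨k, rfl⟩ := Nat.exists_eq_succ_of_ne_zero hk.ne'
  let e : (Fin (k + 1) → G.V) ↪ (Fin (k + 1 + 1) → G.V) :=
    ⟨fun u => Fin.snoc u (u 0), fun u u' h => by
      simpa using congrArg (fun x : Fin (k + 1 + 1) → G.V => fun i => x (Fin.castSucc i)) h⟩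
  have hev : ∀ u, e u = Fin.snoc (α := fun _ => G.V) u (u 0) := fun _ => rfl
  have he : (Finset.univ.filter fun x : Fin (k + 1 + 1) → G.V => x (Fin.last (k + 1)) = x 0) =
      Finset.univ.map e := by
    ext x
    simp only [Finset.mem_filter, Finset.mem_univ, true_and, Finset.mem_map]
    constructor
    · intro h
      refine ⟨fun i => x i.castSucc, funext fun i => ?_⟩
      refine Fin.lastCases ?_ (fun i => ?_) i
      · rw [hev, Fin.snoc_last]
        exact h.symm
      · rw [hev, Fin.snoc_castSucc]
    · rintro ⟨u, rfl⟩
      have : (Fin.snoc u (u 0) : Fin (k + 1 + 1) → G.V) (Fin.castSucc 0) = u 0 :=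
        Fin.snoc_castSucc (α := fun _ => G.V) ..
      rw [hev, Fin.snoc_last]
      exact this.symm
  have he' := congrArg Finset.val he
  rw [Finset.filter_val, Finset.map_val] at he'
  simp only [wlColor, Multiset.filter_map, Multiset.map_map, Function.comp_def,
    initialColor_tupleColor, restrictColor_tupleColor]
  refine Eq.trans ?_ (congrArg _ he'.symm)
  rw [Multiset.map_map]
  refine Multiset.map_congr rfl fun u _ => congrArg _ (funext fun i => ?_)
  rw [hev, Fin.snoc_castSucc]

theorem preceq_klWL_succ (hk : 0 < k) (l : ℕ) :
    Preceq (klWL k l : Algorithm F) (klWL (k + 1) l) := by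
  classical
  intro G H h
  rw [klWL_iff_forall] at h ⊢
  intro t
  have := congrArg (Multiset.map fun M => (M.filter fun c =>
      (initialColor t c).eqPattern (Fin.last k) 0).map (restrictColor t)) (h t)
  simpa only [klColor, Multiset.map_map, Function.comp_def,
    ← wlColor_eq_map_restrictColor hk] using this

end Monotonicity

/-! ### Equal colors as a pebble game -/

section Game

variable {F : Type*} {k : ℕ} {G H : FeaturedGraph F}

theorem isoType_eq_of_tupleColor_eq {t : ℕ} {x : Fin k → G.V} {y : Fin k → H.V}
    (h : tupleColor G t x = tupleColor H t y) : isoType G x = isoType H y := by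
  rw [← initialColor_tupleColor G t, h, initialColor_tupleColor]

theorem exists_update_of_tupleColor_succ_eq {t : ℕ} {x : Fin k → G.V} {y : Fin k → H.V}
    (h : tupleColor G (t + 1) x = tupleColor H (t + 1) y) (i : Fin k) (w : G.V) :
    ∃ w' : H.V, tupleColor G t (Function.update x i w) =
      tupleColor H t (Function.update y i w') := by
  have h2 : ((Finset.univ : Finset G.V).val.map fun w => tupleColor G t (Function.update x i w)) =
      (Finset.univ : Finset H.V).val.map fun w => tupleColor H t (Function.update y i w) :=
    congrFun (congrArg Prod.snd h) i
  have hm : tupleColor G t (Function.update x i w) ∈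
      (Finset.univ : Finset G.V).val.map fun w => tupleColor G t (Function.update x i w) :=
    Multiset.mem_map.2 ⟨w, Finset.mem_univ w, rfl⟩
  obtain ⟨w', -, hw'⟩ := Multiset.mem_map.1 (h2 ▸ hm)
  exact ⟨w', hw'.symm⟩

/-- Replacing the entries of a tuple in the positions `S` costs `#S` rounds. -/
theorem exists_of_tupleColor_add_eq {t : ℕ} (S : Finset (Fin k)) {x : Fin k → G.V}
    {y : Fin k → H.V} (h : tupleColor G (t + S.card) x = tupleColor H (t + S.card) y)
    (x' : Fin k → G.V) (hx' : ∀ i ∉ S, x' i = x i) :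
    ∃ y' : Fin k → H.V, (∀ i ∉ S, y' i = y i) ∧ tupleColor G t x' = tupleColor H t y' := by
  classical
  induction S using Finset.induction_on generalizing x y with
  | empty =>
    obtain rfl : x' = x := funext fun i => hx' i (Finset.notMem_empty i)
    exact ⟨y, fun _ _ => rfl, h⟩
  | insert i S hi ih =>
    rw [Finset.card_insert_of_notMem hi] at h
    obtain ⟨w', hw'⟩ := exists_update_of_tupleColor_succ_eq h i (x' i)
    obtain ⟨y', hy', hc⟩ := ih hw' fun j hj => by
      by_cases hji : j = i
      · subst hji; simp
      · rw [Function.update_of_ne hji]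
        exact hx' j (by simp [hji, hj])
    refine ⟨y', fun j hj => ?_, hc⟩
    rw [Finset.mem_insert, not_or] at hj
    rw [hy' j hj.2, Function.update_of_ne hj.1]

theorem exists_tupleColor_eq_of_klColor_eq {l t : ℕ} {G H : FeaturedGraph F}
    (h : klColor k l t G = klColor k l t H) (v : Fin l → G.V) (x : Fin k → G.V) :
    ∃ (v' : Fin l → H.V) (x' : Fin k → H.V),
      tupleColor (G.label v) t x = tupleColor (H.label v') t x' := by
  have hm : wlColor k t (G.label v) ∈ klColor k l t G :=
    Multiset.mem_map.2 ⟨v, Finset.mem_univ v, rfl⟩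
  obtain ⟨v', -, hv'⟩ := Multiset.mem_map.1 (h ▸ hm)
  have hm' : tupleColor (G.label v) t x ∈ wlColor k t (G.label v) :=
    Multiset.mem_map.2 ⟨x, @Finset.mem_univ _ (_) x, rfl⟩
  obtain ⟨x', -, hx'⟩ := Multiset.mem_map.1 (hv' ▸ hm')
  exact ⟨v', x', hx'.symm⟩

end Game

/-! ### CFI graphs and moving the twist by gauges -/

section CFI

set_option linter.unusedSectionVars false

variable {F : Type*} {I : Type} [Fintype I] [DecidableEq I] (X : SimpleGraph I)
  [DecidableRel X.Adj]

/-- The sum of the values of `a` at the neighbors of `i`. -/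
def neighborSum (i : I) (a : I → ZMod 2) : ZMod 2 := ∑ j, if X.Adj i j then a j else 0

theorem neighborSum_add (i : I) (a b : I → ZMod 2) :
    neighborSum X i (a + b) = neighborSum X i a + neighborSum X i b := by
  simp only [neighborSum, ← Finset.sum_add_distrib, Pi.add_apply]
  exact Finset.sum_congr rfl fun j _ => by split_ifs <;> simp

/-- The Cai–Fürer–Immerman graph over the base graph `X` with twist `τ`. The gadget of the base
node `i` has a node for every assignment `a` of bits to the base nodes; its parity, corrected by the
twist, is part of the feature. -/
def cfi (e : I × ZMod 2 → F) (τ : I → ZMod 2) : FeaturedGraph F where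
  V := I × (I → ZMod 2)
  graph :=
    { Adj := fun p q => X.Adj p.1 q.1 ∧ p.2 q.1 = q.2 p.1
      symm := ⟨fun _ _ h => ⟨h.1.symm, h.2.symm⟩⟩
      loopless := ⟨fun _ h => h.1.ne rfl⟩ }
  feature := fun p => e (p.1, τ p.1 + neighborSum X p.1 p.2)

/-- The permutation of the nodes of a CFI graph that adds `f i` to the bits in the gadget of `i`. -/
def shift (f : I → I → ZMod 2) : Equiv.Perm (I × (I → ZMod 2)) :=
  Equiv.prodShear (Equiv.refl I) fun i => Equiv.addRight (f i)

@[simp] theorem shift_apply (f : I → I → ZMod 2) (p : I × (I → ZMod 2)) :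
    shift f p = (p.1, p.2 + f p.1) := rfl

theorem shift_congr {f g : I → I → ZMod 2} {p : I × (I → ZMod 2)} (h : f p.1 = g p.1) :
    shift f p = shift g p := by simp [h]

theorem shift_update {ι : Type*} [DecidableEq ι] {f g h : I → I → ZMod 2} {i : ι}
    {x : ι → I × (I → ZMod 2)} {w : I × (I → ZMod 2)} (hx : ∀ j, j ≠ i → f (x j).1 = g (x j).1)
    (hw : f w.1 = h w.1) :
    (fun m => shift f (Function.update x i w m)) =
      Function.update (fun m => shift g (x m)) i (shift h w) := by
  funext m
  by_cases hm : m = i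
  · subst hm; simp [hw]
  · simp [hm, hx m hm]

/-- Shifting a tuple by a gauge that depends only on the gadgets of its entries is bijective. -/
theorem bijective_shift_comp {ι : Type} [Finite ι] (h : (ι → I) → I → I → ZMod 2) :
    Function.Bijective fun x : ι → I × (I → ZMod 2) =>
      fun i => shift (h fun j => (x j).1) (x i) := by
  refine Finite.injective_iff_bijective.1 fun x y hxy => ?_
  have hb : (fun j => (x j).1) = fun j => (y j).1 :=
    funext fun j => (congrArg Prod.fst (congrFun hxy j) :
      (shift _ (x j)).1 = (shift _ (y j)).1)
  funext i
  have := congrFun hxy i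
  simp only [hb] at this
  exact (shift _).injective this

/-- The gauge that flips the bit of the base edge `{r, s}`. -/
def flip (r s : I) : I → I → ZMod 2 := fun i j =>
  if (i = r ∧ j = s) ∨ (i = s ∧ j = r) then 1 else 0

theorem flip_symm (r s i j : I) : flip r s i j = flip r s j i := by
  unfold flip; congr 1; apply propext; tauto

theorem flip_of_ne {r s i : I} (hr : i ≠ r) (hs : i ≠ s) : flip r s i = 0 := by
  funext j; simp [flip, hr, hs]

/-- Flipping one edge bit changes the parity at its two ends only. This is what moves a defect from
`r` to `s`. -/
theorem neighborSum_flip {r s : I} (h : X.Adj r s) (i : I) :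
    neighborSum X i (flip r s i) = (if i = r then 1 else 0) + if i = s then 1 else 0 := by
  have hne := h.ne
  by_cases hr : i = r
  · subst hr
    simp only [neighborSum, flip, hne, if_true, if_false, true_and, false_and, or_false, add_zero]
    rw [Finset.sum_eq_single s] <;> simp_all
  · by_cases hs : i = s
    · subst hs
      simp only [neighborSum, flip, hr, if_true, if_false, true_and, false_and, false_or, zero_add]
      rw [Finset.sum_eq_single r] <;> simp_all [h.symm]
    · simp [flip_of_ne hr hs, neighborSum, hr, hs]

variable {X}

theorem map_univ_val_eq {α β γ : Type*} [Fintype α] [Fintype β] (σ : α → β)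
    (hσ : Function.Bijective σ) {f : α → γ} {g : β → γ} (h : ∀ a, f a = g (σ a)) :
    (Finset.univ : Finset α).val.map f = (Finset.univ : Finset β).val.map g := by
  have : (Finset.univ : Finset β) = Finset.univ.map (Equiv.ofBijective σ hσ).toEmbedding := by
    simp
  rw [this, Finset.map_val, Multiset.map_map]
  exact Multiset.map_congr rfl fun a _ => h a

/-- A symmetric gauge changes both bits compared on a base edge by the same amount, so adjacency
survives. Features survive where the gauge compensates the difference of the twists, which is needed
only at the gadgets that the tuple meets. -/
theorem isoType_shift {e : I × ZMod 2 → F} {τ τ' : I → ZMod 2} {k l : ℕ}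
    {f g : I → I → ZMod 2} (hf : ∀ i j, f i j = f j i) {v : Fin l → I × (I → ZMod 2)}
    (hv : ∀ q, f (v q).1 = g (v q).1) {x : Fin k → I × (I → ZMod 2)}
    (hx : ∀ m, τ' (x m).1 + neighborSum X (x m).1 (f (x m).1) = τ (x m).1) :
    isoType ((cfi X e τ).label v) x =
      isoType ((cfi X e τ').label fun q => shift g (v q)) fun m => shift f (x m) := by
  apply IsoType.ext
  · funext i j
    exact propext (shift f).injective.eq_iff.symm
  · funext i
    refine Prod.ext ?_ ?_
    · change e _ = e _
      simp only [shift_apply, neighborSum_add]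
      rw [← hx i]
      congr 2
      ring
    · change {q | v q = x i} = {q | shift g (v q) = shift f (x i)}
      ext q
      simp only [Set.mem_ofPred_eq]
      rw [← shift_congr (hv q), (shift f).injective.eq_iff]
  · funext i j
    change (X.Adj _ _ ∧ _) = (X.Adj _ _ ∧ _)
    simp [hf (x i).1 (x j).1]

theorem exists_mem_forall_ne {C : Finset I} {ι : Type*} (S : Finset ι) (b : ι → I)
    (h : S.card < C.card) : ∃ r ∈ C, ∀ j ∈ S, b j ≠ r := by
  obtain ⟨r, hr, hr'⟩ := Finset.exists_mem_notMem_of_card_lt_card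
    (Finset.card_image_le.trans_lt h : (S.image b).card < C.card)
  exact ⟨r, hr, fun j hj hb => hr' (Finset.mem_image.2 ⟨j, hj, hb⟩)⟩

/-- As long as the defect `r` of the gauge `f` is in a clique of more than `k` unlabeled base nodes
and not in the gadget of an entry of the tuple `x`, shifting `x` by `f` preserves its colors. -/
theorem tupleColor_shift {e : I × ZMod 2 → F} {τ τ' : I → ZMod 2} {k l : ℕ} {C : Finset I}
    (hC : X.IsClique C) (hk : k < C.card) {g : I → I → ZMod 2} {v : Fin l → I × (I → ZMod 2)}
    (hvC : ∀ q, (v q).1 ∉ C) (t : ℕ) {f : I → I → ZMod 2} (hf : ∀ i j, f i j = f j i)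
    (hv : ∀ q, f (v q).1 = g (v q).1) {r : I} (hr : r ∈ C)
    (hd : ∀ i, τ' i + neighborSum X i (f i) = τ i + if i = r then 1 else 0)
    {x : Fin k → I × (I → ZMod 2)} (hx : ∀ m, (x m).1 ≠ r) :
    tupleColor ((cfi X e τ).label v) t x =
      tupleColor ((cfi X e τ').label fun q => shift g (v q)) t fun m => shift f (x m) := by
  induction t generalizing f r x with
  | zero => exact isoType_shift hf hv fun m => by rw [hd, if_neg (hx m), add_zero]
  | succ t ih =>
    refine Prod.ext (ih hf hv hr hd hx) (funext fun i => ?_)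
    -- Writing `r` into the vacated position `i` makes `s` avoid both `r` and the other `k - 1`
    -- entries; these are at most `k` base nodes, fewer than the clique has.
    obtain ⟨s, hs, hsx⟩ := exists_mem_forall_ne Finset.univ
      (Function.update (fun j => (x j).1) i r) (by simpa using hk)
    have hrs : r ≠ s := by simpa using hsx i (Finset.mem_univ i)
    have hxs : ∀ j, j ≠ i → (x j).1 ≠ s := fun j hj => by
      simpa [Function.update_of_ne hj] using hsx j (Finset.mem_univ j)
    let f' : I → I → ZMod 2 := fun b => f b + flip r s b
    have hf' : ∀ b, b ≠ r → b ≠ s → f' b = f b := fun b h1 h2 => by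
      simp [f', flip_of_ne h1 h2]
    -- The answer to a new entry `w`: if it lands in the defective gadget, the defect is first moved
    -- to `s`; otherwise the gauge stays. The choice depends only on the gadget, so this is a
    -- bijection.
    refine map_univ_val_eq (shift fun b => if b = r then f' b else f b) (Equiv.bijective _)
      fun w => ?_
    have hupd : ∀ {b : I}, w.1 ≠ b → (∀ j, j ≠ i → (x j).1 ≠ b) →
        ∀ m, (Function.update x i w m).1 ≠ b := fun hw hxb m => by
      by_cases hm : m = i
      · subst hm; simpa using hw
      · simpa [hm] using hxb m hm
    by_cases hw : w.1 = r
    · refine (ih (f := f') (r := s) (fun a b => ?_) (fun q => ?_) hs (fun b => ?_)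
        (hupd (hw ▸ hrs) hxs)).trans (congrArg _ (shift_update
          (fun j hj => hf' _ (hx j) (hxs j hj)) (by rw [if_pos hw])))
      · simp [f', hf a b, flip_symm r s a b]
      · rw [hf' _ (fun h => hvC q (by rwa [h])) (fun h => hvC q (by rwa [h])), hv]
      · rw [neighborSum_add, ← add_assoc, hd, neighborSum_flip X (hC hr hs hrs), add_assoc,
          ← add_assoc (ite _ _ _), CharTwo.add_self_eq_zero, zero_add]
    · exact (ih hf hv hr hd (hupd hw fun j _ => hx j)).trans (congrArg _ (shift_update
        (fun _ _ => rfl) (by rw [if_neg hw])))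

/-- Each tuple is shifted by its own gauge: `g`, with the defect moved within `C` to a gadget that
the tuple avoids. Labels lie outside `C`, so these moves do not affect them. -/
theorem wlColor_shift {e : I × ZMod 2 → F} {τ τ' : I → ZMod 2} {k l : ℕ} {C : Finset I}
    (hC : X.IsClique C) (hk : k < C.card) {g : I → I → ZMod 2} (hg : ∀ i j, g i j = g j i)
    {v : Fin l → I × (I → ZMod 2)} (hvC : ∀ q, (v q).1 ∉ C) (t : ℕ) {r : I} (hr : r ∈ C)
    (hd : ∀ i, τ' i + neighborSum X i (g i) = τ i + if i = r then 1 else 0) :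
    wlColor k t ((cfi X e τ).label v) =
      wlColor k t ((cfi X e τ').label fun q => shift g (v q)) := by
  have hs : ∀ b : Fin k → I, ∃ s ∈ C, ∀ j, b j ≠ s := fun b => by
    simpa using exists_mem_forall_ne Finset.univ b (by simpa using hk)
  choose s hsC hs using hs
  -- The case `s b = r` is separate because the defect is already in place and there is no edge to
  -- flip.
  refine map_univ_val_eq _ (bijective_shift_comp fun b i =>
    if s b = r then g i else g i + flip r (s b) i) fun x => ?_
  by_cases hsr : s (fun j => (x j).1) = r
  · simp only [hsr, if_true]
    exact tupleColor_shift hC hk hvC t hg (fun _ => rfl) hr hd fun m => hsr ▸ hs (fun j => (x j).1) m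
  · simp only [hsr, if_false]
    refine tupleColor_shift hC hk hvC t (fun a b => ?_) (fun q => ?_) (hsC _) (fun b => ?_)
      (hs fun j => (x j).1)
    · simp [hg a b, flip_symm r _ a b]
    · rw [flip_of_ne (fun h => hvC q (by rwa [h])) (fun h => hvC q (by rw [h]; exact hsC _)), add_zero]
    · rw [neighborSum_add, ← add_assoc, hd, neighborSum_flip X (hC hr (hsC _) (Ne.symm hsr)),
        add_assoc, ← add_assoc (ite _ _ _), CharTwo.add_self_eq_zero, zero_add]

end CFI

/-! ### The base graph and the two separated graphs -/

section Separation

variable {F : Type*} (k l : ℕ)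

/-- The base graph: `l + 1` cliques on `k + 1` nodes, and a center that is adjacent to the last node
of each clique. -/
def base : SimpleGraph (Option (Fin (k + 1) × Fin (l + 1))) where
  Adj
    | none, none => False
    | none, some p => p.1 = Fin.last k
    | some p, none => p.1 = Fin.last k
    | some p, some q => p.1 ≠ q.1 ∧ p.2 = q.2
  symm := ⟨by rintro (_ | p) (_ | q) h <;> first | exact h | exact ⟨h.1.symm, h.2.symm⟩⟩
  loopless := ⟨by rintro (_ | p) h <;> first | exact h | exact h.1 rfl⟩

instance : DecidableRel (base k l).Adj
  | none, none => inferInstanceAs (Decidable False)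
  | none, some p => inferInstanceAs (Decidable (p.1 = Fin.last k))
  | some p, none => inferInstanceAs (Decidable (p.1 = Fin.last k))
  | some p, some q => inferInstanceAs (Decidable (p.1 ≠ q.1 ∧ p.2 = q.2))

variable {k l}

@[simp] theorem base_none_none : ¬ (base k l).Adj none none := id

@[simp] theorem base_none_some (p) : (base k l).Adj none (some p) ↔ p.1 = Fin.last k := Iff.rfl

@[simp] theorem base_some_none (p) : (base k l).Adj (some p) none ↔ p.1 = Fin.last k := Iff.rfl

@[simp] theorem base_some_some (p q) :
    (base k l).Adj (some p) (some q) ↔ p.1 ≠ q.1 ∧ p.2 = q.2 := Iff.rfl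

/-- The twist at the center of the base graph. -/
def centerTwist : Option (Fin (k + 1) × Fin (l + 1)) → ZMod 2 := Pi.single none 1

/-- The nodes of the clique with index `s`. -/
def clique (k : ℕ) {l : ℕ} (s : Fin (l + 1)) : Finset (Option (Fin (k + 1) × Fin (l + 1))) :=
  Finset.univ.map ⟨fun i => some (i, s), fun i j h => by simpa using h⟩

theorem mem_clique {s : Fin (l + 1)} {b : Option (Fin (k + 1) × Fin (l + 1))} :
    b ∈ clique k s ↔ ∃ i, some (i, s) = b := by
  simp only [clique, Finset.mem_map, Finset.mem_univ, true_and]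
  rfl

theorem klColor_cfi_base (e : Option (Fin (k + 1) × Fin (l + 1)) × ZMod 2 → F) (t : ℕ) :
    klColor k l t (cfi (base k l) e 0) = klColor k l t (cfi (base k l) e centerTwist) := by
  have hs : ∀ b : Fin l → Option (Fin (k + 1) × Fin (l + 1)), ∃ s, ∀ q, b q ∉ clique k s := by
    intro b
    -- The default `(0, 0)` counts a label at the center as a hit on clique `0`. This is harmless,
    -- as `l` labels still hit at most `l` cliques.
    obtain ⟨s, -, hs⟩ := exists_mem_forall_ne (C := (Finset.univ : Finset (Fin (l + 1))))
      Finset.univ (fun q => ((b q).getD (0, 0)).2) (by simp)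
    refine ⟨s, fun q hq => ?_⟩
    obtain ⟨i, hi⟩ := mem_clique.1 hq
    exact hs q (Finset.mem_univ q) (by simp [← hi])
  choose s hs using hs
  -- This flip cancels the twist at the center and leaves the defect at the last node of the
  -- unlabeled clique.
  refine map_univ_val_eq _ (bijective_shift_comp fun b => flip none (some (Fin.last k, s b)))
    fun v => ?_
  refine wlColor_shift (C := clique k (s fun j => (v j).1)) ?_ (by simp [clique])
    (flip_symm _ _) (hs fun j => (v j).1) t (mem_clique.2 ⟨Fin.last k, rfl⟩) fun i => ?_
  · intro a ha b hb hab
    obtain ⟨i, rfl⟩ := mem_clique.1 ha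
    obtain ⟨j, rfl⟩ := mem_clique.1 hb
    exact ⟨fun h => hab (by rw [show i = j from h]), rfl⟩
  · rw [neighborSum_flip _ (by simp), ← add_assoc]
    congr 1
    rcases i with _ | i
    · simpa [centerTwist] using CharTwo.add_self_eq_zero (1 : ZMod 2)
    · simp [centerTwist]

/-- Summing the parities in a clique leaves only the bit on the edge to the center. -/
theorem sum_neighborSum_clique (s : Fin (l + 1))
    (a : Fin (k + 1) → Option (Fin (k + 1) × Fin (l + 1)) → ZMod 2)
    (ha : ∀ i j, i ≠ j → a i (some (j, s)) = a j (some (i, s))) :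
    ∑ i, neighborSum (base k l) (some (i, s)) (a i) = a (Fin.last k) none := by
  have h1 : ∀ i, neighborSum (base k l) (some (i, s)) (a i) =
      (if i = Fin.last k then a i none else 0) + ∑ j, if i ≠ j then a i (some (j, s)) else 0 := by
    intro i
    rw [neighborSum, Fintype.sum_option, Fintype.sum_prod_type]
    simp only [base_some_none, base_some_some]
    congr 1
    refine Finset.sum_congr rfl fun j _ => ?_
    rw [Finset.sum_eq_single s]
    · simp
    · intro s' _ h
      simp [Ne.symm h]
    · simp
  -- Each edge inside the clique is counted from both ends with equal bits, so its contributions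
  -- cancel modulo 2.
  have h2 : ∑ i, ∑ j, (if i ≠ j then a i (some (j, s)) else 0) = 0 := by
    rw [← Fintype.sum_prod_type' fun i j => if i ≠ j then a i (some (j, s)) else 0]
    refine Finset.sum_involution (fun p _ => p.swap) (fun p _ => ?_) (fun p _ h => ?_)
      (fun _ _ => Finset.mem_univ _) (fun _ _ => rfl)
    · by_cases h : p.1 = p.2
      · simp [h]
      · simp only [Prod.fst_swap, Prod.snd_swap, ne_eq, h, Ne.symm h, not_false_eq_true, if_true]
        rw [ha _ _ h, CharTwo.add_self_eq_zero]
    · intro hp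
      apply h
      rw [if_neg]
      exact not_not.2 (congrArg Prod.snd hp)
  simp only [h1, Finset.sum_add_distrib, h2, add_zero]
  simp

theorem klColor_succ_cfi_base_ne (hk : 0 < k)
    {e : Option (Fin (k + 1) × Fin (l + 1)) × ZMod 2 → F} (he : Function.Injective e) :
    ∃ t, klColor (k + 1) l t (cfi (base k l) e 0) ≠
      klColor (k + 1) l t (cfi (base k l) e centerTwist) := by
  let I := Option (Fin (k + 1) × Fin (l + 1))
  let S : Finset (Fin (k + 1)) := Finset.univ.erase 0
  -- `k` rounds to place all entries but entry `0`, then one more to move entry `0`.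
  refine ⟨0 + ({0} : Finset (Fin (k + 1))).card + S.card, fun h => ?_⟩
  obtain ⟨v, x, hx⟩ := exists_tupleColor_eq_of_klColor_eq h (fun _ => (none, 0))
    (fun _ => (none, 0))
  have feat : ∀ {b : I} {p : I × (I → ZMod 2)},
      (cfi (base k l) e 0).feature (b, 0) = (cfi (base k l) e centerTwist).feature p →
      p.1 = b ∧ centerTwist b + neighborSum (base k l) b p.2 = 0 := by
    intro b p hp
    have hp := Prod.ext_iff.1 (he hp)
    obtain rfl : b = p.1 := hp.1
    exact ⟨rfl, hp.2.symm.trans (by simp [neighborSum])⟩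
  obtain ⟨hx1, hx2⟩ := feat (congrArg Prod.fst
    (congrFun (congrArg IsoType.features (isoType_eq_of_tupleColor_eq hx)) 0))
  -- The twist makes the bits at the center sum to `1`, so one of them is nonzero.
  obtain ⟨s, hs⟩ : ∃ s, (x 0).2 (some (Fin.last k, s)) ≠ 0 := by
    by_contra! hcon
    have : neighborSum (base k l) none (x 0).2 = 0 := by
      refine Finset.sum_eq_zero fun j _ => ?_
      rcases j with _ | ⟨i, s⟩
      · simp
      · by_cases hi : i = Fin.last k
        · simp [hi, hcon s]
        · simp [hi]
    simp [this, centerTwist] at hx2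
  let z : Fin (k + 1) → I × (I → ZMod 2) := fun i => (some (i, s), 0)
  -- Entry `0` stays at the center while the others enter clique `s`, so that the bit on the edge to
  -- the center is still visible; only then does it take the remaining clique node.
  obtain ⟨y, hy, hyc⟩ := exists_of_tupleColor_add_eq S hx
    (Function.update z 0 (none, 0)) fun i hi => by
      obtain rfl : i = 0 := by simpa [S] using hi
      exact Function.update_self (0 : Fin (k + 1)) _ z
  obtain ⟨z', hz, hzc⟩ := exists_of_tupleColor_add_eq {0} hyc z fun i hi => by
      exact (Function.update_of_ne (by simpa using hi) _ z).symm
  -- Hence the clique node adjacent to the center is placed in the first phase and is unchanged by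
  -- the move of entry `0`.
  have hl : Fin.last k ≠ 0 := fun h => hk.ne' (congrArg Fin.val h)
  have hy0 : y 0 = x 0 := hy 0 (by simp [S])
  have hzl : z' (Fin.last k) = y (Fin.last k) := hz _ (by simpa using hl)
  have hyi := isoType_eq_of_tupleColor_eq hyc
  have hzi := isoType_eq_of_tupleColor_eq hzc
  have hzf : ∀ i, (z' i).1 = some (i, s) ∧
      neighborSum (base k l) (some (i, s)) (z' i).2 = 0 := fun i => by
    have := feat (congrArg Prod.fst (congrFun (congrArg IsoType.features hzi) i))
    simpa [centerTwist] using this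
  have hsum := sum_neighborSum_clique s (fun i => (z' i).2) fun i j hij => by
    have hadj : (cfi (base k l) e 0).graph.Adj (z i) (z j) :=
      ⟨by simpa [z] using hij, rfl⟩
    have := ((congrFun (congrFun (congrArg IsoType.adjPattern hzi) i) j).mp hadj).2
    rwa [(hzf i).1, (hzf j).1] at this
  simp only [(hzf _).2, Finset.sum_const_zero] at hsum
  have hadj : (cfi (base k l) e 0).graph.Adj (Function.update z 0 (none, 0) 0)
      (Function.update z 0 (none, 0) (Fin.last k)) := by
    have h1 : Function.update z 0 (none, 0) 0 = (none, 0) := Function.update_self ..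
    have h2 : Function.update z 0 (none, 0) (Fin.last k) = z (Fin.last k) :=
      Function.update_of_ne hl ..
    rw [h1, h2]
    exact ⟨rfl, rfl⟩
  have := ((congrFun (congrFun (congrArg IsoType.adjPattern hyi) 0) (Fin.last k)).mp hadj).2
  rw [hy0, ← hzl, hx1, (hzf _).1, ← hsum] at this
  exact hs this

end Separation

end KLWL

theorem mainTheorem2 {F : Type*} [Infinite F] (k l : ℕ) (hk : 2 ≤ k) :
    KLWL.Prec (KLWL.klWL k l : KLWL.Algorithm F) (KLWL.klWL (k + 1) l) := by
  have hk0 : 0 < k := by omega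
  refine ⟨KLWL.preceq_klWL_succ hk0 l, fun h => ?_⟩
  let ι := Option (Fin (k + 1) × Fin (l + 1)) × ZMod 2
  let e : ι ↪ F := (Fintype.equivFin ι).toEmbedding.trans
    (Fin.valEmbedding.trans (Infinite.natEmbedding F))
  obtain ⟨t, ht⟩ := KLWL.klColor_succ_cfi_base_ne (l := l) hk0 e.injective
  exact ht (KLWL.klWL_iff_forall.1
    (h.2 _ _ (KLWL.klWL_iff_forall.2 (KLWL.klColor_cfi_base e))) t)
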